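/- All graphs are finite, simple and undirected, with at least one vertex. For a graph $G$ on $n$ vertices let $\lambda_1(G)\ge\lambda_2(G)\ge\dots\ge\lambda_n(G)=\lambda_{\min}(G)$ be the eigenvalues of its adjacency matrix, with multiplicities. Let $\theta(G)=\min_{u,c}\max_{i}\,(c^{\mathsf T}u_i)^{-2}$ be the Lovász theta function, where the minimum is over all unit vectors $c$ and all orthonormal representations $(u_i)$ of $G$ in a Euclidean space (unit vectors $u_i$, one for each vertex, with $u_i^{\mathsf T}u_j=0$ whenever $i\ne j$ are non-adjacent). The strong product $G_1\boxtimes\cdots\boxtimes G_k$ has vertex set $V(G_1)\times\cdots\times V(G_k)$, and two distinct vertices are adjacent if and only if, in every coordinate, their entries are equal or adjacent. A graph is empty if it has no edges. A graph is edge-transitive if every edge can be mapped to every other edge by an automorphism of the graph, and a regular graph is strongly regular if there are integers $a,b\ge 0$ such that any two adjacent vertices have exactly $a$ common neighbours and any two distinct non-adjacent vertices have exactly $b$ common neighbours. Let $G_1,\dots,G_k$ be graphs such that $G_\ell$ is $d_\ell$-regular of order $n_\ell$ for every $\ell$. If $G_\ell$ is empty, so that $d_\ell=\lambda_{\min}(G_\ell)=0$,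 the expression $-\frac{n_\ell\lambda_{\min}(G_\ell)}{d_\ell-\lambda_{\min}(G_\ell)}$ below is read as $n_\ell$, and $1-\frac{d_\ell}{\lambda_{\min}(G_\ell)}$ is read as $1$. (a) Unless all the graphs $G_\ell$ are complete, $$\lambda_2(G_1\boxtimes\cdots\boxtimes G_k)\ \ge\ \frac{\prod_{\ell=1}^k n_\ell-\prod_{\ell=1}^k(1+d_\ell)}{\prod_{\ell=1}^k\theta(G_\ell)-1}-1\ \ge\ \frac{\prod_{\ell=1}^k n_\ell-\prod_{\ell=1}^k(1+d_\ell)}{\prod_{\ell=1}^k\Bigl(-\frac{n_\ell\,\lambda_{\min}(G_\ell)}{d_\ell-\lambda_{\min}(G_\ell)}\Bigr)-1}-1,$$ and the second inequality is an equality if every $G_\ell$ is edge-transitive or strongly regular. (b) Unless all the graphs $G_\ell$ are empty, $$\lambda_{\min}(G_1\boxtimes\cdots\boxtimes G_k)\ \le\ -\frac{\prod_{\ell=1}^k(1+d_\ell)-1}{\prod_{\ell=1}^k\frac{n_\ell}{\theta(G_\ell)}-1}.$$ If every $G_\ell$ is edge-transitive or strongly regular, then the right-hand side is equal to $$-\frac{\prod_{\ell=1}^k(1+d_\ell)-1}{\prod_{\ell=1}^k\Bigl(1-\frac{d_\ell}{\lambda_{\min}(G_\ell)}\Bigr)-1},$$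 so that $\lambda_{\min}(G_1\boxtimes\cdots\boxtimes G_k)$ is at most this quantity. -/

import Mathlib

namespace StrongProductEigenvalues

universe u v

/-! ### Strong products -/

/-- The strong product of two simple graphs: distinct vertices `x`, `y` are adjacent iff
`x.1 = y.1` and `x.2 ~ y.2`, or `x.1 ~ y.1` and `x.2 = y.2`, or `x.1 ~ y.1` and `x.2 ~ y.2`. -/
def strongProd {V : Type u} {W : Type v} (G : SimpleGraph V) (H : SimpleGraph W) :
    SimpleGraph (V × W) where
  Adj x y := (x.1 = y.1 ∧ H.Adj x.2 y.2) ∨ (G.Adj x.1 y.1 ∧ x.2 = y.2) ∨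
    (G.Adj x.1 y.1 ∧ H.Adj x.2 y.2)
  symm := ⟨by
    rintro x y (⟨h, h'⟩ | ⟨h, h'⟩ | ⟨h, h'⟩)
    · exact Or.inl ⟨h.symm, h'.symm⟩
    · exact Or.inr (Or.inl ⟨h.symm, h'.symm⟩)
    · exact Or.inr (Or.inr ⟨h.symm, h'.symm⟩)⟩
  loopless := ⟨by
    rintro x (⟨_, h⟩ | ⟨h, _⟩ | ⟨h, _⟩)
    · exact H.irrefl h
    · exact G.irrefl h
    · exact G.irrefl h⟩

/-- The strong product `G₁ ⊠ ⋯ ⊠ G_k`, on the Cartesian product of the vertex sets: two distinct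
vertices are adjacent iff in every coordinate they are equal or adjacent. -/
def strongProduct {k : ℕ} {V : Fin k → Type u} (G : ∀ l, SimpleGraph (V l)) :
    SimpleGraph (∀ l, V l) where
  Adj x y := x ≠ y ∧ ∀ l, x l = y l ∨ (G l).Adj (x l) (y l)
  symm := ⟨fun _ _ h => ⟨h.1.symm, fun l => (h.2 l).imp Eq.symm SimpleGraph.Adj.symm⟩⟩
  loopless := ⟨fun _ h => h.1 rfl⟩

/-- The `k`-fold strong product is the iterated binary strong product (up to the canonical
identification of the vertex sets). -/
def strongProductSuccIso {k : ℕ} {V : Fin (k + 1) → Type u} (G : ∀ l, SimpleGraph (V l)) :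
    strongProd (G 0) (strongProduct fun l : Fin k => G l.succ) ≃g strongProduct G where
  toEquiv := Fin.consEquiv V
  map_rel_iff' := by
    rintro ⟨a, x⟩ ⟨b, y⟩
    have key : ∀ h : a = b, ((G 0).Adj a b ↔ False) := by
      rintro rfl
      simp
    by_cases h : a = b <;> by_cases h' : x = y <;>
      simp [strongProd, strongProduct, Fin.consEquiv, Fin.forall_fin_succ, Fin.cons_inj, h, h']

/-! ### Eigenvalues of graphs -/

open Classical in
/-- The eigenvalues of the adjacency matrix of a finite graph, with multiplicities and listed in
decreasing order: the entry at index `j` is `λ_{j+1}(G)`. -/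
noncomputable def adjEigenvalue {V : Type u} [Fintype V] (G : SimpleGraph V) :
    Fin (Fintype.card V) → ℝ :=
  Matrix.IsHermitian.eigenvalues₀ (A := G.adjMatrix ℝ)
    (by
      rw [Matrix.IsHermitian, Matrix.conjTranspose_eq_transpose_of_trivial]
      exact G.transpose_adjMatrix)

/-- The second-largest eigenvalue `λ₂(G)`, counted with multiplicity
(the value `0` on graphs with at most one vertex is never used). -/
noncomputable def secondEigenvalue {V : Type u} [Fintype V] (G : SimpleGraph V) : ℝ :=
  if h : 1 < Fintype.card V then adjEigenvalue G ⟨1, h⟩ else 0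

/-- The smallest eigenvalue `λ_min(G)` of a graph with at least one vertex. -/
noncomputable def minEigenvalue {V : Type u} [Fintype V] [Nonempty V] (G : SimpleGraph V) : ℝ :=
  adjEigenvalue G ⟨Fintype.card V - 1, Nat.sub_one_lt Fintype.card_ne_zero⟩

/-! ### The Lovász theta function -/

/-- `w` is an orthonormal representation of `G` in `ℝᵐ`: all vectors are unit vectors, and distinct
non-adjacent vertices receive orthogonal vectors. -/
def IsOrthonormalRep {V : Type u} (G : SimpleGraph V) {m : ℕ}
    (w : V → EuclideanSpace ℝ (Fin m)) : Prop :=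
  (∀ i, ‖w i‖ = 1) ∧ ∀ i j, i ≠ j → ¬ G.Adj i j → inner ℝ (w i) (w j) = 0

/-- The Lovász theta function: the minimum of `max_i 1 / (cᵀ u_i)²` over all orthonormal
representations `u` of `G` (in any dimension) and all unit vectors `c`. Pairs with `cᵀ u_i = 0` for
some `i`, whose value is `+∞`, are left out. -/
noncomputable def lovaszTheta {V : Type u} (G : SimpleGraph V) : ℝ :=
  sInf {t : ℝ | ∃ (m : ℕ) (w : V → EuclideanSpace ℝ (Fin m)) (c : EuclideanSpace ℝ (Fin m)),
    IsOrthonormalRep G w ∧ ‖c‖ = 1 ∧ (∀ i, inner ℝ c (w i) ≠ 0) ∧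
      t = ⨆ i, 1 / (inner ℝ c (w i)) ^ 2}

/-- Lovász's eigenvalue bound `-n λ_min(G) / (d - λ_min(G))` on the theta function of a `d`-regular
graph of order `n`. For an empty graph (`d = 0 = λ_min(G)`) the quotient has the form `0 / 0`, and
it is read as `n`. -/
noncomputable def lovaszBound {V : Type u} [Fintype V] [Nonempty V] (G : SimpleGraph V) (d : ℕ) :
    ℝ :=
  if d = 0 then (Fintype.card V : ℝ)
  else -((Fintype.card V : ℝ) * minEigenvalue G) / ((d : ℝ) - minEigenvalue G)

/-! ### Edge-transitive and strongly regular graphs -/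

/-- Any edge can be moved to any other edge (as unordered pairs) by an automorphism. -/
def IsEdgeTransitive {V : Type u} (G : SimpleGraph V) : Prop :=
  ∀ e ∈ G.edgeSet, ∀ e' ∈ G.edgeSet, ∃ f : G ≃g G, Sym2.map f e = e'

/-- Strongly regular with some parameters `(n, d, a, b)`. -/
def IsStronglyRegular {V : Type u} [Fintype V] (G : SimpleGraph V) [DecidableRel G.Adj] : Prop :=
  open Classical in ∃ n d a b : ℕ, G.IsSRGWith n d a b

end StrongProductEigenvalues

namespace StrongProductEigenvalues

open Matrix

/-! ### Real quadratic forms -/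

section Forms

variable {V : Type*} [Fintype V]

/-! The theta function is the common value of two semidefinite programs, with `J` the all-ones
matrix: the least `s` such that some `Z` with diagonal `s`, vanishing on non-adjacent pairs, has `Z
- J` positive semidefinite; and the largest entry sum of a positive semidefinite `Q` of trace one
vanishing on edges. Kronecker products preserve feasibility in both, so theta is multiplicative on
strong products (`lovaszTheta_strongProduct`).

The strong product is regular of degree `∏ (1 + d l) - 1`, so both parts reduce to inequalities for
a single `d`-regular graph of order `n` with adjacency matrix `A`. For (a), the dual matrix `J - A +
λ₂ I` gives `n - d + λ₂ ≤ θ (1 + λ₂)` (`le_lovaszTheta_of_form_le`). For (b), a primal matrix `t I +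
q A` gives `θ ≤ -n λ_min / (d - λ_min)` (`lovaszTheta_le_lovaszBound`). Each is solved for the
eigenvalue.

The last bound is sharp for edge-transitive graphs, by summing a primal matrix over the automorphism
group, and for strongly regular graphs, where `A` is annihilated by a quadratic polynomial on
sum-zero vectors. -/

/-- The all-ones matrix. -/
def onesMatrix (V : Type*) : Matrix V V ℝ := Matrix.of fun _ _ => 1

omit [Fintype V] in
@[simp] theorem onesMatrix_apply (i j : V) : onesMatrix V i j = 1 := rfl

theorem onesMatrix_mulVec (x : V → ℝ) : onesMatrix V *ᵥ x = fun _ => ∑ i, x i := by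
  ext i
  simp [onesMatrix, mulVec, dotProduct]

theorem dotProduct_onesMatrix_mulVec (x y : V → ℝ) :
    x ⬝ᵥ onesMatrix V *ᵥ y = (∑ i, x i) * ∑ i, y i := by
  rw [onesMatrix_mulVec, dotProduct, Finset.sum_mul]

theorem posSemidef_real_iff {M : Matrix V V ℝ} :
    M.PosSemidef ↔ M.IsSymm ∧ ∀ x : V → ℝ, 0 ≤ x ⬝ᵥ M *ᵥ x := by
  rw [posSemidef_iff_dotProduct_mulVec, IsHermitian, conjTranspose_eq_transpose_of_trivial]
  simp [Matrix.IsSymm]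

theorem dotProduct_mulVec_eq_sum (M : Matrix V V ℝ) (x y : V → ℝ) :
    x ⬝ᵥ M *ᵥ y = ∑ i, ∑ j, M i j * (x i * y j) := by
  simp only [dotProduct, mulVec, Finset.mul_sum]
  exact Finset.sum_congr rfl fun i _ => Finset.sum_congr rfl fun j _ => by ring

theorem isSymm_dotProduct_mulVec {M : Matrix V V ℝ} (hM : M.IsSymm) (x y : V → ℝ) :
    x ⬝ᵥ M *ᵥ y = y ⬝ᵥ M *ᵥ x := by
  rw [dotProduct_mulVec, ← mulVec_transpose, hM.eq, dotProduct_comm]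

theorem posSemidef_onesMatrix : (onesMatrix V).PosSemidef := by
  refine posSemidef_real_iff.2 ⟨by ext; simp [transpose_apply], fun x => ?_⟩
  rw [dotProduct_onesMatrix_mulVec]
  exact mul_self_nonneg _

theorem PosSemidef.exists_gram {M : Matrix V V ℝ} (hM : M.PosSemidef) :
    ∃ u : V → EuclideanSpace ℝ V, ∀ i j, M i j = inner ℝ (u i) (u j) := by
  classical
  open scoped MatrixOrder Matrix.Norms.L2Operator in
  obtain ⟨a, rfl⟩ := CStarAlgebra.nonneg_iff_eq_star_mul_self.mp hM.nonneg
  refine ⟨fun i => WithLp.toLp 2 fun k => a k i, fun i j => ?_⟩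
  simp [mul_apply, PiLp.inner_apply, star_eq_conjTranspose, mul_comm]

omit [Fintype V] in
theorem PosSemidef.hadamard_real {P Q : Matrix V V ℝ} (hP : P.PosSemidef) (hQ : Q.PosSemidef) :
    (P ⊙ Q).PosSemidef := hP.hadamard hQ

omit [Fintype V] in
theorem posSemidef_gram_real [Finite V] {E : Type*} [NormedAddCommGroup E]
    [InnerProductSpace ℝ E] (v : V → E) : (gram ℝ v).PosSemidef := posSemidef_gram ℝ v

/-- By the Schur product theorem, evaluated at the all-ones vector. -/
theorem PosSemidef.sum_mul_nonneg {P Q : Matrix V V ℝ} (hP : P.PosSemidef) (hQ : Q.PosSemidef) :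
    0 ≤ ∑ i, ∑ j, P i j * Q i j := by
  have := (posSemidef_real_iff.1 (hP.hadamard hQ)).2 fun _ => 1
  simpa [dotProduct_mulVec_eq_sum] using this

theorem posSemidef_hadamard_prod {ι : Type*} (s : Finset ι) (M : ι → Matrix V V ℝ)
    (hM : ∀ l ∈ s, (M l).PosSemidef) :
    (Matrix.of fun x y => ∏ l ∈ s, M l x y : Matrix V V ℝ).PosSemidef := by
  classical
  induction s using Finset.induction_on with
  | empty => simpa using! posSemidef_onesMatrix (V := V)
  | insert a s ha ih =>
    have := PosSemidef.hadamard_real (hM a (Finset.mem_insert_self _ _))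
      (ih fun l hl => hM l (Finset.mem_insert_of_mem hl))
    convert this using 1
    ext x y
    simp [Finset.prod_insert ha]

/-- If `P` is the product over `s`, then `M a ⊙ P - J = (M a - J) ⊙ P + (P - J)`, and `P = (P - J) +
J` is itself positive semidefinite. -/
theorem posSemidef_hadamard_prod_sub_ones {ι : Type*} (s : Finset ι) (M : ι → Matrix V V ℝ)
    (hM : ∀ l ∈ s, (M l - onesMatrix V).PosSemidef) :
    ((Matrix.of fun x y => ∏ l ∈ s, M l x y) - onesMatrix V).PosSemidef := by
  classical
  induction s using Finset.induction_on with
  | empty =>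
    convert Matrix.PosSemidef.zero (n := V) (R := ℝ) using 1
    ext x y
    simp
  | insert a s ha ih =>
    have h1 := hM a (Finset.mem_insert_self _ _)
    have h2 := ih fun l hl => hM l (Finset.mem_insert_of_mem hl)
    have h3 := (PosSemidef.hadamard_real h1 (h2.add posSemidef_onesMatrix)).add h2
    convert h3 using 1
    ext x y
    simp [Finset.prod_insert ha]
    ring

/-- A symmetric matrix with constant row sum `μ ≥ 0` is positive semidefinite as soon as its
quadratic form is nonnegative on the vectors of sum zero. -/
theorem posSemidef_of_constant_rowSum {M : Matrix V V ℝ} (hM : M.IsSymm) {μ : ℝ} (hμ : 0 ≤ μ)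
    (h1 : M *ᵥ (fun _ => 1) = fun _ => μ)
    (h : ∀ y : V → ℝ, ∑ i, y i = 0 → 0 ≤ y ⬝ᵥ M *ᵥ y) : M.PosSemidef := by
  refine posSemidef_real_iff.2 ⟨hM, fun x => ?_⟩
  rcases isEmpty_or_nonempty V with hV | hV
  · simp [dotProduct]
  have hc : (Fintype.card V : ℝ) ≠ 0 := by exact_mod_cast Fintype.card_ne_zero
  set a : ℝ := (∑ i, x i) / Fintype.card V with ha
  set e : V → ℝ := fun _ => 1 with he
  set y : V → ℝ := x - a • e with hy
  have hy0 : ∑ i, y i = 0 := by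
    simp [hy, he, Finset.sum_sub_distrib, ha]
    field_simp
    simp
  have hx : x = a • e + y := by simp [hy]
  -- The cross term between the constant part and the sum-zero part of `x` vanishes because `M *ᵥ e`
  -- is constant.
  have hye : y ⬝ᵥ M *ᵥ e = 0 := by
    rw [h1]
    simp [dotProduct, ← Finset.sum_mul, hy0]
  have hee : 0 ≤ e ⬝ᵥ M *ᵥ e := by
    rw [h1]
    simp only [dotProduct, he]
    positivity
  rw [hx, mulVec_add, mulVec_smul, dotProduct_add, add_dotProduct, add_dotProduct,
    smul_dotProduct, dotProduct_smul, dotProduct_smul, smul_dotProduct,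
    isSymm_dotProduct_mulVec hM e y, hye]
  have := h y hy0
  simp only [smul_eq_mul, mul_zero, add_zero, zero_add]
  nlinarith [mul_nonneg (mul_self_nonneg a) hee]

section Spectral

variable [DecidableEq V] {A : Matrix V V ℝ} (hA : A.IsHermitian)

theorem dotProduct_self_eq_sum_eigen (x : V → ℝ) :
    x ⬝ᵥ x = ∑ i, (hA.eigenvectorBasis i ⬝ᵥ x) ^ 2 := by
  have := hA.eigenvectorBasis.sum_inner_mul_inner (WithLp.toLp 2 x) (WithLp.toLp 2 x)
  simp only [EuclideanSpace.inner_eq_star_dotProduct, star_trivial] at this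
  rw [← this]
  exact Finset.sum_congr rfl fun i _ => by rw [dotProduct_comm x, sq]

theorem dotProduct_mulVec_eq_sum_eigen (x : V → ℝ) :
    x ⬝ᵥ A *ᵥ x = ∑ i, hA.eigenvalues i * (hA.eigenvectorBasis i ⬝ᵥ x) ^ 2 := by
  have := hA.eigenvectorBasis.sum_inner_mul_inner (WithLp.toLp 2 x) (WithLp.toLp 2 (A *ᵥ x))
  simp only [EuclideanSpace.inner_eq_star_dotProduct, star_trivial] at this
  rw [dotProduct_comm, ← this]
  refine Finset.sum_congr rfl fun i _ => ?_
  have hs : A.IsSymm := by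
    rw [Matrix.IsSymm, ← conjTranspose_eq_transpose_of_trivial]; exact hA
  rw [dotProduct_comm (A *ᵥ x), isSymm_dotProduct_mulVec hs, hA.mulVec_eigenvectorBasis,
    dotProduct_smul, smul_eq_mul, dotProduct_comm x]
  ring

end Spectral

end Forms

/-! ### The semidefinite programs of the theta function -/

/-- Feasibility of `Z` with value `s` in the minimisation program for the theta function. -/
structure IsThetaPrimal {V : Type*} (G : SimpleGraph V) (s : ℝ) (Z : Matrix V V ℝ) : Prop where
  diag : ∀ i, Z i i = s
  nonadj : ∀ i j, i ≠ j → ¬ G.Adj i j → Z i j = 0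
  psd : (Z - onesMatrix V).PosSemidef

/-- Feasibility of `Q`, up to scaling, in the maximisation program for the theta function. -/
structure IsThetaDual {V : Type*} (G : SimpleGraph V) (Q : Matrix V V ℝ) : Prop where
  psd : Q.PosSemidef
  adj : ∀ i j, G.Adj i j → Q i j = 0

section

variable {V : Type*} {G : SimpleGraph V}

theorem IsThetaPrimal.one_le [Nonempty V] {s : ℝ} {Z : Matrix V V ℝ} (hZ : IsThetaPrimal G s Z) :
    1 ≤ s := by
  obtain ⟨i⟩ := ‹Nonempty V›
  have := hZ.psd.diag_nonneg (i := i)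
  simp [hZ.diag] at this
  exact this

/-- Off the diagonal `Z` and `Q` have disjoint supports, so pairing `Z - J` with `Q` leaves `s *
Q.trace` minus the entry sum of `Q`. -/
theorem IsThetaPrimal.weak_duality [Fintype V] {s : ℝ} {Z Q : Matrix V V ℝ}
    (hZ : IsThetaPrimal G s Z) (hQ : IsThetaDual G Q) : ∑ i, ∑ j, Q i j ≤ s * Q.trace := by
  classical
  have h := PosSemidef.sum_mul_nonneg hZ.psd hQ.psd
  have h2 : ∀ i j, (Z - onesMatrix V) i j * Q i j =
      (if i = j then s * Q i i else 0) - Q i j := by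
    intro i j
    by_cases hij : i = j
    · subst hij
      simp [hZ.diag]
      ring
    · by_cases ha : G.Adj i j
      · simp [hQ.adj i j ha, hij]
      · simp [hZ.nonadj i j hij ha, hij]
  simp only [h2, Finset.sum_sub_distrib, Finset.sum_ite_eq, Finset.mem_univ, if_true] at h
  rw [Matrix.trace, Finset.mul_sum]
  simpa using h

/-- Rescale to `z i = w i / ⟨c, w i⟩`, so that `⟨c, z i⟩ = 1`. The Gram matrix of `z i - c` is then
that of `z` minus `J`, and raising the diagonal to `t` keeps it positive semidefinite. -/
theorem IsThetaPrimal.exists_of_orthonormalRep [Finite V] {m : ℕ}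
    {w : V → EuclideanSpace ℝ (Fin m)}
    {c : EuclideanSpace ℝ (Fin m)} (hw : IsOrthonormalRep G w) (hc : ‖c‖ = 1)
    (hcw : ∀ i, inner ℝ c (w i) ≠ 0) {t : ℝ} (ht : ∀ i, 1 / (inner ℝ c (w i)) ^ 2 ≤ t) :
    ∃ Z, IsThetaPrimal G t Z := by
  classical
  set z : V → EuclideanSpace ℝ (Fin m) := fun i => (inner ℝ c (w i))⁻¹ • w i with hz
  have hzz : ∀ i, inner ℝ (z i) (z i) = 1 / (inner ℝ c (w i)) ^ 2 := by
    intro i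
    simp only [hz, inner_smul_left, inner_smul_right, real_inner_self_eq_norm_sq, hw.1 i]
    simp
    ring
  have hcz : ∀ i, inner ℝ c (z i) = 1 := fun i => by
    simp [hz, inner_smul_right, inv_mul_cancel₀ (hcw i)]
  have hpsd := (posSemidef_gram_real fun i => z i - c).add
    (PosSemidef.diagonal (d := fun i => t - inner ℝ (z i) (z i))
      (fun i => by simp only [hzz]; exact sub_nonneg.2 (ht i)))
  refine ⟨Matrix.of fun i j => if i = j then t else inner ℝ (z i) (z j), ?_, ?_, ?_⟩
  · intro i
    simp
  · intro i j hij ha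
    simp [hij, hz, inner_smul_left, inner_smul_right, hw.2 i j hij ha]
  · convert hpsd using 1
    ext i j
    have hcc : inner ℝ c c = (1 : ℝ) := by rw [real_inner_self_eq_norm_sq, hc]; norm_num
    by_cases hij : i = j
    · subst hij
      simp only [Matrix.sub_apply, of_apply, if_true, onesMatrix_apply, Matrix.add_apply, gram_apply,
        diagonal_apply_eq, inner_sub_left, inner_sub_right, hcz, real_inner_comm c, hcc]
      ring
    · simp only [Matrix.sub_apply, of_apply, if_neg hij, onesMatrix_apply, Matrix.add_apply, gram_apply,
        diagonal_apply_ne _ hij, inner_sub_left, inner_sub_right, hcz, real_inner_comm c, hcc]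
      ring

/-- Write `Z - J` as a Gram matrix and adjoin a coordinate equal to 1: the Gram matrix becomes `Z`.
Dividing by `√s` gives unit vectors, and the new axis serves as `c`, with all values equal to `s`.
-/
theorem IsThetaPrimal.mem_thetaSet [Fintype V] [Nonempty V] {s : ℝ} {Z : Matrix V V ℝ}
    (hZ : IsThetaPrimal G s Z) :
    ∃ (m : ℕ) (w : V → EuclideanSpace ℝ (Fin m)) (c : EuclideanSpace ℝ (Fin m)),
    IsOrthonormalRep G w ∧ ‖c‖ = 1 ∧ (∀ i, inner ℝ c (w i) ≠ 0) ∧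
      s = ⨆ i, 1 / (inner ℝ c (w i)) ^ 2 := by
  classical
  obtain ⟨x, hx⟩ := PosSemidef.exists_gram hZ.psd
  have hs : 0 < s := lt_of_lt_of_le one_pos hZ.one_le
  have hsq : √s ≠ 0 := (Real.sqrt_pos.2 hs).ne'
  let e : EuclideanSpace ℝ (Option V) ≃ₗᵢ[ℝ] EuclideanSpace ℝ (Fin (Fintype.card (Option V))) :=
    LinearIsometryEquiv.piLpCongrLeft 2 ℝ ℝ (Fintype.equivFin (Option V))
  let c : EuclideanSpace ℝ (Option V) := WithLp.toLp 2 fun o => o.elim 1 fun _ => 0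
  let w : V → EuclideanSpace ℝ (Option V) := fun i =>
    (√s)⁻¹ • WithLp.toLp 2 fun o => o.elim 1 fun k => x i k
  have hcc : inner ℝ c c = (1 : ℝ) := by
    simp only [c, PiLp.inner_apply, Fintype.sum_option]
    simp
  have hcw : ∀ i, inner ℝ c (w i) = (√s)⁻¹ := fun i => by
    simp [c, w, inner_smul_right, PiLp.inner_apply, Fintype.sum_option]
  have hww : ∀ i j, inner ℝ (w i) (w j) = s⁻¹ * Z i j := fun i j => by
    have h : inner ℝ (x i) (x j) = Z i j - 1 := by rw [← hx]; simp
    rw [PiLp.inner_apply] at h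
    simp only [w, inner_smul_left, inner_smul_right, PiLp.inner_apply, Fintype.sum_option,
      Option.elim, h]
    have : s⁻¹ = (√s)⁻¹ * (√s)⁻¹ := by rw [← mul_inv, Real.mul_self_sqrt hs.le]
    simp [this]
    ring
  refine ⟨_, fun i => e (w i), e c, ⟨fun i => ?_, fun i j hij ha => ?_⟩, ?_, fun i => ?_, ?_⟩
  · rw [LinearIsometryEquiv.norm_map, norm_eq_sqrt_real_inner, hww, hZ.diag,
      inv_mul_cancel₀ hs.ne', Real.sqrt_one]
  · rw [LinearIsometryEquiv.inner_map_map, hww, hZ.nonadj i j hij ha, mul_zero]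
  · rw [LinearIsometryEquiv.norm_map, norm_eq_sqrt_real_inner, hcc, Real.sqrt_one]
  · rw [LinearIsometryEquiv.inner_map_map, hcw]
    exact inv_ne_zero hsq
  · simp only [LinearIsometryEquiv.inner_map_map, hcw, inv_pow, Real.sq_sqrt hs.le]
    simp

theorem lovaszTheta_set_eq [Fintype V] [Nonempty V] (G : SimpleGraph V) :
    {t : ℝ | ∃ (m : ℕ) (w : V → EuclideanSpace ℝ (Fin m)) (c : EuclideanSpace ℝ (Fin m)),
    IsOrthonormalRep G w ∧ ‖c‖ = 1 ∧ (∀ i, inner ℝ c (w i) ≠ 0) ∧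
      t = ⨆ i, 1 / (inner ℝ c (w i)) ^ 2} = {t | ∃ Z, IsThetaPrimal G t Z} := by
  ext t
  constructor
  · rintro ⟨m, w, c, hw, hc, hcw, rfl⟩
    exact IsThetaPrimal.exists_of_orthonormalRep hw hc hcw fun i =>
      le_ciSup (f := fun i => 1 / (inner ℝ c (w i)) ^ 2) (Set.finite_range _).bddAbove i
  · rintro ⟨Z, hZ⟩
    exact hZ.mem_thetaSet

theorem exists_isThetaPrimal [Fintype V] (G : SimpleGraph V) :
    IsThetaPrimal G (Fintype.card V) (open Classical in
      (Fintype.card V : ℝ) • (1 : Matrix V V ℝ)) := by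
  classical
  refine ⟨by simp, fun i j hij _ => by simp [hij], posSemidef_of_constant_rowSum ?_ le_rfl ?_ ?_⟩
  · ext i j
    simp [transpose_apply, one_apply, eq_comm]
  · ext i
    simp [sub_mulVec, onesMatrix_mulVec, smul_mulVec]
  · intro y hy
    rw [sub_mulVec, dotProduct_sub, dotProduct_onesMatrix_mulVec, hy, smul_mulVec, one_mulVec,
      dotProduct_smul]
    have : 0 ≤ y ⬝ᵥ y := Finset.sum_nonneg fun i _ => mul_self_nonneg _
    simp only [smul_eq_mul, mul_zero, sub_zero]
    positivity

variable [Fintype V] [Nonempty V]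

theorem lovaszTheta_le {s : ℝ} {Z : Matrix V V ℝ} (hZ : IsThetaPrimal G s Z) :
    lovaszTheta G ≤ s := by
  rw [lovaszTheta, lovaszTheta_set_eq]
  exact csInf_le ⟨1, fun t ⟨_, h⟩ => h.one_le⟩ ⟨Z, hZ⟩

theorem le_lovaszTheta {r : ℝ} (h : ∀ s Z, IsThetaPrimal G s Z → r ≤ s) : r ≤ lovaszTheta G := by
  rw [lovaszTheta, lovaszTheta_set_eq]
  exact le_csInf ⟨_, _, exists_isThetaPrimal G⟩ fun t ⟨Z, hZ⟩ => h t Z hZ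

omit [Fintype V] [Nonempty V] in
theorem IsThetaPrimal.mono {s t : ℝ} {Z : Matrix V V ℝ} (hZ : IsThetaPrimal G s Z) (h : s ≤ t) :
    ∃ Z', IsThetaPrimal G t Z' := by
  classical
  refine ⟨Z + (t - s) • 1, fun i => by simp [hZ.diag], fun i j hij ha => by
    simp [hij, hZ.nonadj i j hij ha], ?_⟩
  rw [add_sub_right_comm]
  exact hZ.psd.add (PosSemidef.one.smul (sub_nonneg.2 h))

/-- The strict inequality avoids showing that the primal infimum is attained. -/
theorem exists_isThetaPrimal_of_lt {s : ℝ} (h : lovaszTheta G < s) :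
    ∃ Z, IsThetaPrimal G s Z := by
  rw [lovaszTheta, lovaszTheta_set_eq] at h
  have hne : {t | ∃ Z, IsThetaPrimal G t Z}.Nonempty := ⟨_, _, exists_isThetaPrimal G⟩
  obtain ⟨t, ⟨Z, hZ⟩, ht⟩ := exists_lt_of_csInf_lt hne h
  exact hZ.mono ht.le

theorem one_le_lovaszTheta (G : SimpleGraph V) : 1 ≤ lovaszTheta G :=
  le_lovaszTheta fun _ _ h => h.one_le

theorem IsThetaDual.sum_le {Q : Matrix V V ℝ} (hQ : IsThetaDual G Q) :
    ∑ i, ∑ j, Q i j ≤ lovaszTheta G * Q.trace := by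
  rcases hQ.psd.trace_nonneg.eq_or_lt with h | h
  · have := (exists_isThetaPrimal G).weak_duality hQ
    rwa [← h, mul_zero] at this ⊢
  · rw [← div_le_iff₀ h]
    exact le_lovaszTheta fun s Z hZ => (div_le_iff₀ h).2 (hZ.weak_duality hQ)

/-- The indicator `x` of a non-adjacent pair gives the dual matrix `x xᵀ` with entry sum 4 and trace
2, so theta is at least 2. -/
theorem one_lt_lovaszTheta (h : G ≠ ⊤) : 1 < lovaszTheta G := by
  classical
  obtain ⟨a, b, hab, hn⟩ : ∃ a b, a ≠ b ∧ ¬ G.Adj a b := by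
    by_contra! hc
    exact h (top_le_iff.1 fun a b hab => hc a b hab)
  let x : V → ℝ := Pi.single a 1 + Pi.single b 1
  have hQ : IsThetaDual G (vecMulVec x x) := by
    refine ⟨by simpa using posSemidef_vecMulVec_self_star x, fun i j hij => ?_⟩
    simp only [vecMulVec_apply, x, Pi.add_apply, Pi.single_apply]
    by_cases h1 : i = a <;> by_cases h2 : i = b <;> by_cases h3 : j = a <;> by_cases h4 : j = b <;>
      simp_all [SimpleGraph.adj_comm]
  have h1 := hQ.sum_le
  have hsum : ∑ i, ∑ j, vecMulVec x x i j = 4 := by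
    simp only [vecMulVec_apply, ← Finset.mul_sum, ← Finset.sum_mul]
    simp [x, Finset.sum_add_distrib]
    norm_num
  have htr : (vecMulVec x x).trace = 2 := by
    rw [trace_vecMulVec]
    simp [x, hab, hab.symm]
    norm_num
  rw [hsum, htr] at h1
  linarith

end

/-! ### Strong duality -/

section

variable {V : Type*} [Fintype V]

/-- The positive semidefinite matrices of trace one. -/
def spectraplex (V : Type*) [Fintype V] : Set (V → V → ℝ) :=
  {Q | (Matrix.of Q).PosSemidef ∧ ∑ i, Q i i = 1}

theorem convex_spectraplex : Convex ℝ (spectraplex V) := by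
  intro P hP Q hQ a b ha hb hab
  refine ⟨(hP.1.smul ha).add (hQ.1.smul hb), ?_⟩
  simp [Finset.sum_add_distrib, ← Finset.mul_sum, hP.2, hQ.2, hab]

theorem PosSemidef.two_mul_abs_le {Q : Matrix V V ℝ} (hQ : Q.PosSemidef) (i j : V) :
    2 * |Q i j| ≤ Q i i + Q j j := by
  classical
  have hs : Q j i = Q i j := (posSemidef_real_iff.1 hQ).1.apply i j
  have h1 := (posSemidef_real_iff.1 hQ).2 (Pi.single i 1 + Pi.single j 1)
  have h2 := (posSemidef_real_iff.1 hQ).2 (Pi.single i 1 - Pi.single j 1)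
  simp [mulVec_add, mulVec_sub, add_dotProduct, sub_dotProduct] at h1 h2
  rcases abs_cases (Q i j) with h | h <;> linarith

theorem isCompact_spectraplex : IsCompact (spectraplex V) := by
  refine (isCompact_Icc (a := fun _ _ => (-1 : ℝ)) (b := fun _ _ => (1 : ℝ))).of_isClosed_subset
    ?_ ?_
  · have : spectraplex V = {Q : V → V → ℝ | ∀ i j, Q j i = Q i j} ∩
        {Q | ∀ x : V → ℝ, 0 ≤ ∑ i, ∑ j, Q i j * (x i * x j)} ∩ {Q | ∑ i, Q i i = 1} := by
      ext Q
      simp only [spectraplex, posSemidef_real_iff, dotProduct_mulVec_eq_sum, Set.mem_ofPred_eq,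
        Set.mem_inter_iff, IsSymm.ext_iff, of_apply]
    rw [this]
    refine IsClosed.inter (IsClosed.inter ?_ ?_) ?_
    · simp only [Set.ofPred_forall]
      exact isClosed_iInter fun i => isClosed_iInter fun j =>
        isClosed_eq (by fun_prop) (by fun_prop)
    · simp only [Set.ofPred_forall]
      exact isClosed_iInter fun x => isClosed_le (by fun_prop) (by fun_prop)
    · exact isClosed_eq (by fun_prop) (by fun_prop)
  · rintro Q ⟨hQ, htr⟩
    have hd : ∀ i, Q i i ≤ 1 := fun i => by
      rw [← htr]
      exact Finset.single_le_sum (f := fun i => Q i i) (fun j _ => hQ.diag_nonneg (i := j))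
        (Finset.mem_univ i)
    have h : ∀ i j, |Q i j| ≤ 1 := fun i j => by
      have := PosSemidef.two_mul_abs_le hQ i j
      simp only [of_apply] at this
      linarith [hd i, hd j]
    exact ⟨fun i j => (abs_le.1 (h i j)).1, fun i j => (abs_le.1 (h i j)).2⟩

open Classical in
/-- The entries of a matrix on the edges of `G`, together with the sum of all its entries. -/
noncomputable def edgeData (G : SimpleGraph V) : (V → V → ℝ) →ₗ[ℝ] (V → V → ℝ) × ℝ where
  toFun Q := (fun i j => if G.Adj i j then Q i j else 0, ∑ i, ∑ j, Q i j)
  map_add' P Q := by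
    ext i j
    · by_cases h : G.Adj i j <;> simp [h]
    · simp [Finset.sum_add_distrib]
  map_smul' a Q := by
    ext i j
    · by_cases h : G.Adj i j <;> simp [h]
    · simp [Finset.mul_sum]

theorem continuous_edgeData (G : SimpleGraph V) : Continuous (edgeData G) :=
  LinearMap.continuous_of_finiteDimensional _

theorem rankOne_mem_spectraplex {x : V → ℝ} (hx : x ⬝ᵥ x = 1) :
    (fun i j => x i * x j) ∈ spectraplex V :=
  ⟨by simpa using! posSemidef_vecMulVec_self_star x, hx⟩

/-- A linear functional on matrices is given by a matrix. -/
theorem linear_apply_eq_sum [DecidableEq V] (f : (V → V → ℝ) →ₗ[ℝ] ℝ) (Q : V → V → ℝ) :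
    f Q = ∑ i, ∑ j, Q i j * f (Pi.single i (Pi.single j 1)) := by
  have : Q = ∑ i, ∑ j, Q i j • Pi.single i (Pi.single j (1 : ℝ)) := by
    ext a b
    simp [Finset.sum_apply, Pi.single_apply, ite_apply]
  conv_lhs => rw [this]
  simp

/-- Hahn–Banach separates the compact convex image of the spectraplex under `edgeData` from `{0} ×
[s, ∞)`. The functional consists of edge weights `Y` and a coefficient `α` of the entry sum; testing
it on rank-one matrices shows that `s I - W - J` is positive semidefinite, with `W` the symmetrised
weights divided by `α`. -/
theorem exists_isThetaPrimal_of_dual_lt [Nonempty V] {G : SimpleGraph V} {s : ℝ}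
    (h : ∀ Q : Matrix V V ℝ, IsThetaDual G Q → Q.trace = 1 → ∑ i, ∑ j, Q i j < s) :
    ∃ Z, IsThetaPrimal G s Z := by
  classical
  obtain ⟨f, u, v, hu, huv, hv⟩ := geometric_hahn_banach_compact_closed
    (s := edgeData G '' spectraplex V) (t := {0} ×ˢ Set.Ici s)
    (convex_spectraplex.linear_image _) (isCompact_spectraplex.image (continuous_edgeData G))
    ((convex_singleton _).prod (convex_Ici s)) (isClosed_singleton.prod isClosed_Ici) (by
      rw [Set.disjoint_left]
      rintro _ ⟨Q, hQ, rfl⟩ ⟨h1, h2⟩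
      refine (h (Matrix.of Q) ⟨hQ.1, fun i j hij => ?_⟩ hQ.2).not_ge h2
      have := congrFun (congrFun h1 i) j
      simpa [edgeData, hij] using this)
  set α : ℝ := f (0, 1) with hα
  have hf2 : ∀ r, f (0, r) = r * α := fun r => by
    rw [hα, ← smul_eq_mul, ← map_smul]
    simp
  have hf : ∀ q r, f (q, r) = f (q, 0) + r * α := fun q r => by
    rw [← hf2, ← map_add]
    simp
  let g : (V → V → ℝ) →ₗ[ℝ] ℝ := f.toLinearMap ∘ₗ LinearMap.inl ℝ _ _
  set Y : V → V → ℝ := fun i j => g (Pi.single i (Pi.single j 1)) with hY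
  have hK : ∀ Q ∈ spectraplex V,
      ∑ i, ∑ j, (if G.Adj i j then Q i j else 0) * Y i j + (∑ i, ∑ j, Q i j) * α < u := by
    intro Q hQ
    have := hu _ ⟨Q, hQ, rfl⟩
    simp only [edgeData, LinearMap.coe_mk, AddHom.coe_mk] at this
    rw [hf] at this
    have hg := linear_apply_eq_sum g (fun i j => if G.Adj i j then Q i j else 0)
    simp only [g, LinearMap.comp_apply, LinearMap.inl_apply] at hg
    erw [hg] at this
    exact this
  have hvr : ∀ r, s ≤ r → v < r * α := fun r hr => by
    rw [← hf2]
    exact hv _ ⟨rfl, hr⟩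
  have hn : (0 : ℝ) < Fintype.card V := by exact_mod_cast Fintype.card_pos
  -- The matrix `I / n` has zero edge data and entry sum 1, so `α < u < v < max s 1 * α`.
  have hαpos : 0 < α := by
    have hQ : (fun i j : V => if i = j then (Fintype.card V : ℝ)⁻¹ else 0) ∈ spectraplex V := by
      refine ⟨?_, by simp [hn.ne']⟩
      convert (PosSemidef.one (n := V) (R := ℝ)).smul (inv_nonneg.2 hn.le) using 1
      ext i j
      simp [one_apply]
    have h0 := hK _ hQ
    have h1 : ∀ i j : V, (if G.Adj i j then
        (if i = j then (Fintype.card V : ℝ)⁻¹ else 0) else 0) * Y i j = 0 := by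
      intro i j
      by_cases hij : i = j
      · subst hij; simp
      · simp [hij]
    simp only [h1] at h0
    simp [hn.ne'] at h0
    have h2 := hvr (max s 1) (le_max_left _ _)
    have h3 : 0 < (max s 1 - 1) * α := by linarith
    exact pos_of_mul_pos_right h3 (by linarith [le_max_right s 1])
  have hs : u < s * α := huv.trans (hvr s le_rfl)
  set W : V → V → ℝ := fun i j => if G.Adj i j then (Y i j + Y j i) / (2 * α) else 0 with hW
  have hWsymm : ∀ i j, W i j = W j i := fun i j => by
    simp only [hW, G.adj_comm i j, add_comm]
  have hquad : ∀ x : V → ℝ, ∑ i, ∑ j, W i j * (x i * x j) + (∑ i, x i) ^ 2 ≤ s * (x ⬝ᵥ x) := by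
    intro x
    by_cases hx : x = 0
    · subst hx; simp
    have hxx : 0 < x ⬝ᵥ x := by
      refine lt_of_le_of_ne (Finset.sum_nonneg fun i _ => mul_self_nonneg _) fun h => hx ?_
      exact dotProduct_self_eq_zero.1 h.symm
    set c : ℝ := (√(x ⬝ᵥ x))⁻¹ with hc
    have hcc : c * c * (x ⬝ᵥ x) = 1 := by
      rw [hc, ← mul_inv, Real.mul_self_sqrt hxx.le, inv_mul_cancel₀ hxx.ne']
    have := hK _ (rankOne_mem_spectraplex (x := c • x) (by
      rw [smul_dotProduct, dotProduct_smul, smul_eq_mul, smul_eq_mul, ← mul_assoc, hcc]))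
    have hswap : ∑ i, ∑ j, (if G.Adj i j then x i * x j else 0) * Y j i =
        ∑ i, ∑ j, (if G.Adj i j then x i * x j else 0) * Y i j := by
      rw [Finset.sum_comm]
      simp only [G.adj_comm, mul_comm (x _) (x _)]
    have hWY : ∑ i, ∑ j, W i j * (x i * x j) =
        α⁻¹ * ∑ i, ∑ j, (if G.Adj i j then x i * x j else 0) * Y i j := by
      have h2 : ∀ i j, W i j * (x i * x j) = (2 * α)⁻¹ *
          ((if G.Adj i j then x i * x j else 0) * Y i j +
            (if G.Adj i j then x i * x j else 0) * Y j i) := by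
        intro i j
        by_cases hij : G.Adj i j
        · simp only [hW, if_pos hij]
          field_simp
        · simp [hW, hij]
      simp only [h2, ← Finset.mul_sum, Finset.sum_add_distrib, hswap]
      field_simp
      ring
    have h3 : ∑ i, ∑ j, (if G.Adj i j then (c • x) i * (c • x) j else 0) * Y i j =
        c * c * ∑ i, ∑ j, (if G.Adj i j then x i * x j else 0) * Y i j := by
      simp only [Finset.mul_sum]
      refine Finset.sum_congr rfl fun i _ => Finset.sum_congr rfl fun j _ => ?_
      by_cases hij : G.Adj i j
      · simp [hij]; ring
      · simp [hij]
    have h4 : ∑ i, ∑ j, (c • x) i * (c • x) j = c * c * (∑ i, x i) ^ 2 := by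
      simp only [Pi.smul_apply, smul_eq_mul, ← Finset.mul_sum, ← Finset.sum_mul]
      ring
    rw [h3, h4] at this
    have h5 : ∑ i, ∑ j, (if G.Adj i j then x i * x j else 0) * Y i j =
        α * ∑ i, ∑ j, W i j * (x i * x j) := by
      rw [hWY, mul_inv_cancel_left₀ hαpos.ne']
    rw [h5] at this
    have hcpos : 0 < c * c := by
      by_contra hneg
      nlinarith
    have h6 : c * c * α * (∑ i, ∑ j, W i j * (x i * x j) + (∑ i, x i) ^ 2) <
        c * c * α * (s * (x ⬝ᵥ x)) := by
      calc _ < s * α := by linarith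
        _ = (c * c * (x ⬝ᵥ x)) * (s * α) := by rw [hcc, one_mul]
        _ = _ := by ring
    exact (lt_of_mul_lt_mul_left h6 (mul_pos hcpos hαpos).le).le
  refine ⟨Matrix.of fun i j => (if i = j then s else 0) - W i j, fun i => by simp [hW],
    fun i j hij ha => by simp [hW, hij, ha], posSemidef_real_iff.2 ⟨?_, fun x => ?_⟩⟩
  · ext i j
    simp [transpose_apply, hWsymm i j, eq_comm]
  · have h1 := hquad x
    have h2 : s * (x ⬝ᵥ x) = ∑ i, ∑ j, (if i = j then s else 0) * (x i * x j) := by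
      simp [dotProduct, Finset.mul_sum, ite_mul]
    rw [sub_mulVec, dotProduct_sub, dotProduct_onesMatrix_mulVec, dotProduct_mulVec_eq_sum]
    simp only [of_apply, sub_mul, Finset.sum_sub_distrib]
    rw [← h2]
    linarith

/-- Strong duality: the theta function is attained by a feasible matrix of the dual program. -/
theorem exists_isThetaDual [Nonempty V] (G : SimpleGraph V) :
    ∃ Q : Matrix V V ℝ, IsThetaDual G Q ∧ Q.trace = 1 ∧ ∑ i, ∑ j, Q i j = lovaszTheta G := by
  classical
  have hn : (0 : ℝ) < Fintype.card V := by exact_mod_cast Fintype.card_pos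
  have hcl : IsClosed {Q : V → V → ℝ | ∀ i j, G.Adj i j → Q i j = 0} := by
    simp only [Set.ofPred_forall]
    exact isClosed_iInter fun i => isClosed_iInter fun j => isClosed_iInter fun _ =>
      isClosed_eq (by fun_prop) (by fun_prop)
  obtain ⟨Q, hQ, hmax⟩ := (isCompact_spectraplex.inter_right hcl).exists_isMaxOn
    ⟨fun i j : V => if i = j then (Fintype.card V : ℝ)⁻¹ else 0, ⟨by
      convert (PosSemidef.one (n := V) (R := ℝ)).smul (inv_nonneg.2 hn.le) using 1
      ext i j
      simp [one_apply], by simp [hn.ne']⟩, fun i j hij => by simp [hij.ne]⟩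
    (f := fun Q => ∑ i, ∑ j, Q i j) (by fun_prop)
  have hd : IsThetaDual G (Matrix.of Q) := ⟨hQ.1.1, hQ.2⟩
  have htr : (Matrix.of Q).trace = 1 := hQ.1.2
  refine ⟨Matrix.of Q, hd, htr, le_antisymm ?_ ?_⟩
  · have := hd.sum_le
    rwa [htr, mul_one] at this
  -- Every `s` above the dual maximum is primal feasible, hence bounds theta from above.
  · refine le_of_forall_gt_imp_ge_of_dense fun s hs => ?_
    obtain ⟨Z, hZ⟩ := exists_isThetaPrimal_of_dual_lt (G := G) (s := s)
      fun P hP hPtr => lt_of_le_of_lt (hmax ⟨⟨hP.psd, hPtr⟩, hP.adj⟩) hs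
    exact lovaszTheta_le hZ

end

/-! ### Extremal eigenvalues of regular graphs -/

section

variable {V : Type*} [Fintype V] {G : SimpleGraph V} [DecidableRel G.Adj] {d : ℕ}

omit [Fintype V] in
theorem adjMatrix_isSymm (G : SimpleGraph V) [DecidableRel G.Adj] : (G.adjMatrix ℝ).IsSymm :=
  G.transpose_adjMatrix

theorem adjMatrix_mulVec_one (hd : G.IsRegularOfDegree d) :
    G.adjMatrix ℝ *ᵥ (fun _ => 1) = fun _ => (d : ℝ) := by
  ext i
  simpa using! SimpleGraph.adjMatrix_mulVec_const_apply_of_regular (a := (1 : ℝ)) hd (v := i)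

theorem sum_mulVec_adjMatrix (hd : G.IsRegularOfDegree d) (x : V → ℝ) :
    ∑ i, (G.adjMatrix ℝ *ᵥ x) i = d * ∑ i, x i := by
  have := isSymm_dotProduct_mulVec (adjMatrix_isSymm G) (fun _ => 1) x
  rw [adjMatrix_mulVec_one hd] at this
  simpa [dotProduct, ← Finset.sum_mul, mul_comm] using this

theorem degree_succ_le_card [Nonempty V] (hd : G.IsRegularOfDegree d) :
    d + 1 ≤ Fintype.card V := by
  obtain ⟨i⟩ := ‹Nonempty V›
  rw [← hd i]
  exact G.degree_lt_card_verts i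

/-- For a regular graph the Laplacian is `d I - A`, and it is positive semidefinite. -/
theorem dotProduct_adjMatrix_le (hd : G.IsRegularOfDegree d) (x : V → ℝ) :
    x ⬝ᵥ G.adjMatrix ℝ *ᵥ x ≤ d * (x ⬝ᵥ x) := by
  classical
  have := (posSemidef_real_iff.1 (G.posSemidef_lapMatrix ℝ)).2 x
  rw [SimpleGraph.lapMatrix, sub_mulVec, dotProduct_sub] at this
  have h : x ⬝ᵥ G.degMatrix ℝ *ᵥ x = d * (x ⬝ᵥ x) := by
    simp only [SimpleGraph.degMatrix, dotProduct, mulVec_diagonal, Finset.mul_sum]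
    refine Finset.sum_congr rfl fun i _ => ?_
    rw [hd i]
    ring
  linarith

theorem minEigenvalue_mul_le [Nonempty V] (x : V → ℝ) :
    minEigenvalue G * (x ⬝ᵥ x) ≤ x ⬝ᵥ G.adjMatrix ℝ *ᵥ x := by
  classical
  have hA : (G.adjMatrix ℝ).IsHermitian := by
    rw [Matrix.IsHermitian, conjTranspose_eq_transpose_of_trivial]
    exact G.transpose_adjMatrix
  have hmin : ∀ i, minEigenvalue G ≤ hA.eigenvalues i := by
    intro i
    have : minEigenvalue G =
        hA.eigenvalues₀ ⟨Fintype.card V - 1, Nat.sub_one_lt Fintype.card_ne_zero⟩ := by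
      -- The definition carries classical decidability instances; `congr!` identifies them with the
      -- local ones.
      unfold minEigenvalue adjEigenvalue
      congr!
    rw [this]
    exact hA.eigenvalues₀_antitone (Fin.le_def.2 (Nat.le_sub_one_of_lt (Fin.is_lt _)))
  rw [dotProduct_mulVec_eq_sum_eigen hA, dotProduct_self_eq_sum_eigen hA, Finset.mul_sum]
  exact Finset.sum_le_sum fun i _ => mul_le_mul_of_nonneg_right (hmin i) (sq_nonneg _)

theorem exists_minEigenvector [Nonempty V] (G : SimpleGraph V) [DecidableRel G.Adj] :
    ∃ v : V → ℝ, 0 < v ⬝ᵥ v ∧ G.adjMatrix ℝ *ᵥ v = minEigenvalue G • v := by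
  classical
  have hA : (G.adjMatrix ℝ).IsHermitian := by
    rw [Matrix.IsHermitian, conjTranspose_eq_transpose_of_trivial]
    exact G.transpose_adjMatrix
  set i : V := Fintype.equivOfCardEq (Fintype.card_fin _)
    (⟨Fintype.card V - 1, Nat.sub_one_lt Fintype.card_ne_zero⟩ : Fin (Fintype.card V)) with hi
  have : minEigenvalue G = hA.eigenvalues i := by
    unfold minEigenvalue adjEigenvalue IsHermitian.eigenvalues
    rw [hi, Equiv.symm_apply_apply]
    congr!
  refine ⟨hA.eigenvectorBasis i, ?_, this ▸ hA.mulVec_eigenvectorBasis i⟩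
  have h1 := hA.eigenvectorBasis.inner_eq_one i
  rw [EuclideanSpace.inner_eq_star_dotProduct, star_trivial] at h1
  rw [h1]
  exact one_pos

theorem minEigenvalue_le_neg_one [Nonempty V] {a b : V} (h : G.Adj a b) :
    minEigenvalue G ≤ -1 := by
  classical
  have := minEigenvalue_mul_le (G := G) (Pi.single a 1 - Pi.single b 1)
  simp [mulVec_sub, sub_dotProduct, SimpleGraph.adjMatrix_apply, h, h.symm, h.ne, h.ne.symm] at this
  linarith

theorem minEigenvalue_neg [Nonempty V] (hd : G.IsRegularOfDegree d) (h0 : d ≠ 0) :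
    minEigenvalue G < 0 := by
  obtain ⟨a⟩ := ‹Nonempty V›
  obtain ⟨b, hb⟩ := (G.degree_pos_iff_exists_adj a).1 (by rw [hd a]; omega)
  linarith [minEigenvalue_le_neg_one hb]

theorem sum_eq_zero_of_minEigenvector [Nonempty V] (hd : G.IsRegularOfDegree d) (h0 : d ≠ 0)
    {v : V → ℝ} (hv : G.adjMatrix ℝ *ᵥ v = minEigenvalue G • v) : ∑ i, v i = 0 := by
  have h := sum_mulVec_adjMatrix hd v
  simp only [hv, Pi.smul_apply, smul_eq_mul, ← Finset.mul_sum] at h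
  have hneg := minEigenvalue_neg hd h0
  have hd0 : (0 : ℝ) ≤ d := Nat.cast_nonneg d
  have : (d - minEigenvalue G) * ∑ i, v i = 0 := by linarith
  exact (mul_eq_zero.1 this).resolve_left (by linarith)

/-- The first basis eigenvector `v` need not be the all-ones vector `e` (the graph may be
disconnected). The form is at most `λ₂` on the complement of `v`. If `d ≤ λ₂` the claim is clear.
Otherwise `v` is not orthogonal to `e`; applying the bound to `a • y - b • e`, orthogonal to `v`,
the `e` terms can be dropped because `d > λ₂`. -/
theorem dotProduct_adjMatrix_le_second (hd : G.IsRegularOfDegree d) (hV : 1 < Fintype.card V)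
    {y : V → ℝ} (hy : ∑ i, y i = 0) :
    y ⬝ᵥ G.adjMatrix ℝ *ᵥ y ≤ secondEigenvalue G * (y ⬝ᵥ y) := by
  classical
  have : Nonempty V := Fintype.card_pos_iff.1 (by omega)
  have hA : (G.adjMatrix ℝ).IsHermitian := by
    rw [Matrix.IsHermitian, conjTranspose_eq_transpose_of_trivial]
    exact G.transpose_adjMatrix
  have h2 : secondEigenvalue G = hA.eigenvalues₀ ⟨1, hV⟩ := by
    unfold secondEigenvalue adjEigenvalue
    rw [dif_pos hV]
    congr!
  set i₀ : V := Fintype.equivOfCardEq (Fintype.card_fin _)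
    (⟨0, by omega⟩ : Fin (Fintype.card V)) with hi₀
  set v : V → ℝ := ⇑(hA.eigenvectorBasis i₀) with hv
  have hle : ∀ i, i ≠ i₀ → hA.eigenvalues i ≤ secondEigenvalue G := by
    intro i hi
    rw [h2]
    refine hA.eigenvalues₀_antitone (Fin.le_def.2 (Nat.one_le_iff_ne_zero.2 fun h => hi ?_))
    rw [hi₀, ← Equiv.symm_apply_eq]
    exact Fin.ext h
  have hform : ∀ x : V → ℝ, v ⬝ᵥ x = 0 →
      x ⬝ᵥ G.adjMatrix ℝ *ᵥ x ≤ secondEigenvalue G * (x ⬝ᵥ x) := by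
    intro x hx
    rw [dotProduct_mulVec_eq_sum_eigen hA, dotProduct_self_eq_sum_eigen hA, Finset.mul_sum]
    refine Finset.sum_le_sum fun i _ => ?_
    by_cases hi : i = i₀
    · rw [hi, ← hv, hx]
      simp
    · exact mul_le_mul_of_nonneg_right (hle i hi) (sq_nonneg _)
  set e : V → ℝ := fun _ => 1 with he
  have hAe : G.adjMatrix ℝ *ᵥ e = (d : ℝ) • e := by
    rw [adjMatrix_mulVec_one hd]
    ext
    simp [he]
  have hn : 0 < e ⬝ᵥ e := by simp [he, dotProduct, Fintype.card_pos]
  have hyy : 0 ≤ y ⬝ᵥ y := Finset.sum_nonneg fun i _ => mul_self_nonneg _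
  have hye : y ⬝ᵥ e = 0 := by simpa [dotProduct, he] using hy
  have hey : e ⬝ᵥ y = 0 := by rw [dotProduct_comm, hye]
  rcases le_or_gt (d : ℝ) (secondEigenvalue G) with hcase | hcase
  · exact (dotProduct_adjMatrix_le hd y).trans (mul_le_mul_of_nonneg_right hcase hyy)
  by_cases hve : v ⬝ᵥ e = 0
  · have := hform e hve
    rw [hAe, dotProduct_smul, smul_eq_mul] at this
    exact absurd (le_of_mul_le_mul_right this hn) hcase.not_ge
  set a := v ⬝ᵥ e with ha
  set b := v ⬝ᵥ y with hb
  have hx := hform (a • y - b • e) (by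
    rw [dotProduct_sub, dotProduct_smul, dotProduct_smul, smul_eq_mul, smul_eq_mul]
    ring)
  have heAy : e ⬝ᵥ G.adjMatrix ℝ *ᵥ y = 0 := by
    rw [isSymm_dotProduct_mulVec (adjMatrix_isSymm G), hAe, dotProduct_smul, hye, smul_zero]
  simp only [mulVec_sub, mulVec_smul, dotProduct_sub, sub_dotProduct, smul_dotProduct,
    dotProduct_smul, hAe, hye, hey, heAy, smul_eq_mul, mul_zero, sub_zero, zero_sub] at hx
  have hpos : 0 < a * a := mul_self_pos.2 hve
  have hbb : 0 ≤ (b * b) * ((d - secondEigenvalue G) * (e ⬝ᵥ e)) :=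
    mul_nonneg (mul_self_nonneg b) (mul_nonneg (by linarith) hn.le)
  refine le_of_mul_le_mul_left ?_ hpos
  linarith

/-- Test on the difference of two basis vectors. This supplies the condition `-1 ≤ r` of
`le_lovaszTheta_of_form_le`. -/
theorem neg_one_le_secondEigenvalue (hd : G.IsRegularOfDegree d) (hV : 1 < Fintype.card V) :
    -1 ≤ secondEigenvalue G := by
  classical
  obtain ⟨a, b, hab⟩ := Fintype.exists_pair_of_one_lt_card hV
  have := dotProduct_adjMatrix_le_second hd hV (y := Pi.single a 1 - Pi.single b 1) (by simp)
  have hle : ∀ i j, G.adjMatrix ℝ i j ≤ 1 := fun i j => by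
    rw [SimpleGraph.adjMatrix_apply]
    split_ifs <;> norm_num
  have h1 := hle a b
  have h2 := hle b a
  simp [mulVec_sub, sub_dotProduct, hab, hab.symm, -SimpleGraph.adjMatrix_apply] at this
  simp at h1 h2 this
  linarith

end

/-! ### Eigenvalue bounds on the theta function of a regular graph -/

section

variable {V : Type*} [Fintype V] [Nonempty V] {G : SimpleGraph V} [DecidableRel G.Adj] {d : ℕ}

theorem lovaszBound_eq_iff (hd : G.IsRegularOfDegree d) (h0 : d ≠ 0) (t : ℝ) :
    t = lovaszBound G d ↔
      t * (d - minEigenvalue G) = -(Fintype.card V * minEigenvalue G) := by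
  have := minEigenvalue_neg hd h0
  have hd0 : (0 : ℝ) ≤ d := Nat.cast_nonneg d
  rw [lovaszBound, if_neg h0, eq_div_iff (by linarith)]

theorem lovaszBound_le_iff (hd : G.IsRegularOfDegree d) (h0 : d ≠ 0) (t : ℝ) :
    lovaszBound G d ≤ t ↔
      -(Fintype.card V * minEigenvalue G) ≤ t * (d - minEigenvalue G) := by
  have := minEigenvalue_neg hd h0
  have hd0 : (0 : ℝ) ≤ d := Nat.cast_nonneg d
  rw [lovaszBound, if_neg h0, div_le_iff₀ (by linarith)]

/-- Lovász's eigenvalue bound on the theta function of a regular graph. -/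
theorem lovaszTheta_le_lovaszBound (hd : G.IsRegularOfDegree d) :
    lovaszTheta G ≤ lovaszBound G d := by
  classical
  by_cases h0 : d = 0
  · rw [lovaszBound, if_pos h0]
    exact lovaszTheta_le (exists_isThetaPrimal G)
  set t := lovaszBound G d with ht
  set l := minEigenvalue G with hl
  have hneg : l < 0 := minEigenvalue_neg hd h0
  have hd0 : (0 : ℝ) ≤ d := Nat.cast_nonneg d
  have hdl : 0 < d - l := by linarith
  have htl : t * (d - l) = -(Fintype.card V * l) := (lovaszBound_eq_iff hd h0 t).1 ht
  -- With this `q`, `t I + q A - J` kills the all-ones vector; since `t = -q l`, it acts as `q (A -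
  -- l I)` on sum-zero vectors.
  set q : ℝ := Fintype.card V / (d - l) with hq
  have hq0 : 0 ≤ q := by positivity
  have hqd : q * (d - l) = Fintype.card V := div_mul_cancel₀ _ hdl.ne'
  have htq : t = -(q * l) := by
    apply mul_right_cancel₀ hdl.ne'
    rw [htl, ← hqd]
    ring
  refine lovaszTheta_le (Z := t • 1 + q • G.adjMatrix ℝ) ⟨fun i => by simp, fun i j hij ha => by
    simp [hij, ha], posSemidef_of_constant_rowSum (μ := t + q * d - Fintype.card V) ?_ ?_ ?_ ?_⟩
  · ext i j
    simp [transpose_apply, one_apply, SimpleGraph.adjMatrix_apply, eq_comm, G.adj_comm]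
  · rw [htq, ← hqd]
    ring_nf
    rfl
  · ext i
    rw [sub_mulVec, add_mulVec, smul_mulVec, smul_mulVec, adjMatrix_mulVec_one hd,
      onesMatrix_mulVec]
    simp
  · intro y hy
    rw [sub_mulVec, add_mulVec, smul_mulVec, smul_mulVec, dotProduct_sub, dotProduct_add,
      dotProduct_onesMatrix_mulVec, hy, dotProduct_smul, dotProduct_smul, one_mulVec]
    have := mul_le_mul_of_nonneg_left (minEigenvalue_mul_le (G := G) y) hq0
    simp only [smul_eq_mul, mul_zero, sub_zero, htq]
    rw [← hl] at this
    linarith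

/-- The lower bound on the theta function of a regular graph given by an upper bound on the
quadratic form of its adjacency matrix on the vectors of sum zero. -/
theorem le_lovaszTheta_of_form_le (hd : G.IsRegularOfDegree d) {r : ℝ} (hr : -1 ≤ r)
    (h : ∀ y : V → ℝ, ∑ i, y i = 0 → y ⬝ᵥ G.adjMatrix ℝ *ᵥ y ≤ r * (y ⬝ᵥ y)) :
    Fintype.card V - d + r ≤ lovaszTheta G * (1 + r) := by
  classical
  have hcard : (d : ℝ) + 1 ≤ Fintype.card V := by exact_mod_cast degree_succ_le_card hd
  have h1 : (onesMatrix V - G.adjMatrix ℝ + r • 1) *ᵥ (fun _ => 1) =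
      fun _ => (Fintype.card V - d + r : ℝ) := by
    ext i
    rw [add_mulVec, sub_mulVec, smul_mulVec, adjMatrix_mulVec_one hd, onesMatrix_mulVec]
    simp
  -- On sum-zero vectors this is `r I - A`; the row sum is nonnegative because `d + 1 ≤ n` and `-1 ≤
  -- r`.
  have hQ : IsThetaDual G (onesMatrix V - G.adjMatrix ℝ + r • 1) := by
    refine ⟨posSemidef_of_constant_rowSum (μ := Fintype.card V - d + r) ?_ (by linarith) h1 ?_,
      fun i j hij => by simp [hij, hij.ne]⟩
    · ext i j
      simp [transpose_apply, one_apply, SimpleGraph.adjMatrix_apply, eq_comm, G.adj_comm]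
    · intro y hy
      rw [add_mulVec, sub_mulVec, smul_mulVec, dotProduct_add, dotProduct_sub,
        dotProduct_onesMatrix_mulVec, hy, dotProduct_smul, one_mulVec]
      have := h y hy
      simp only [smul_eq_mul, mul_zero]
      linarith
  have hsum : ∑ i, ∑ j, (onesMatrix V - G.adjMatrix ℝ + r • 1) i j =
      Fintype.card V * (Fintype.card V - d + r : ℝ) := by
    have : ∀ i, ∑ j, (onesMatrix V - G.adjMatrix ℝ + r • 1) i j = Fintype.card V - d + r :=
      fun i => by simpa [mulVec, dotProduct] using congrFun h1 i
    simp only [this, Finset.sum_const, Finset.card_univ, nsmul_eq_mul]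
  have htr : (onesMatrix V - G.adjMatrix ℝ + r • 1).trace = Fintype.card V * (1 + r) := by
    simp [Matrix.trace]
    ring
  have hn : (0 : ℝ) < Fintype.card V := by exact_mod_cast Fintype.card_pos
  have := hQ.sum_le
  rw [hsum, htr] at this
  refine le_of_mul_le_mul_left ?_ hn
  linarith

/-- On sum-zero vectors `(A - r)(A - l) = 0` with `l` the least eigenvalue, so the form is at most
`r` there. The resulting lower bound on theta equals Lovász's bound by the parameter identity `d (d
- a - 1) = (n - d - 1) b`. -/
theorem lovaszBound_le_of_not_complete_of_isSRGWith {n a b : ℕ} (h : G.IsSRGWith n d a b)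
    (h0 : d ≠ 0) (htop : G ≠ ⊤) : lovaszBound G d ≤ lovaszTheta G := by
  classical
  have hd := h.regular
  set l := minEigenvalue G with hl
  have hneg : l < 0 := minEigenvalue_neg hd h0
  -- In a complete graph `b` would be arbitrary.
  have hbd : (b : ℝ) ≤ d := by
    obtain ⟨u, v, huv, hn⟩ : ∃ u v, u ≠ v ∧ ¬ G.Adj u v := by
      by_contra! hc
      exact htop (top_le_iff.1 fun u v huv => hc u v huv)
    have := G.card_commonNeighbors_le_degree_left u v
    rw [hd u] at this
    rw [← h.of_not_adj huv hn]
    exact_mod_cast this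
  have hsq : ∀ y : V → ℝ, ∑ i, y i = 0 → G.adjMatrix ℝ *ᵥ G.adjMatrix ℝ *ᵥ y =
      (d - b : ℝ) • y + (a - b : ℝ) • G.adjMatrix ℝ *ᵥ y := by
    intro y hy
    have hc : Gᶜ.adjMatrix ℝ = onesMatrix V - 1 - G.adjMatrix ℝ := by
      ext i j
      by_cases hij : i = j
      · subst hij; simp
      · by_cases ha : G.Adj i j <;> simp [hij, ha]
    rw [mulVec_mulVec, ← sq, h.matrix_eq, hc]
    simp only [add_mulVec, smul_mulVec, sub_mulVec, one_mulVec, onesMatrix_mulVec, hy]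
    ext i
    simp
    ring
  obtain ⟨v, hv0, hv⟩ := exists_minEigenvector G
  rw [← hl] at hv
  have hvs := sum_eq_zero_of_minEigenvector hd h0 hv
  have hroot : l * l = (d - b) + (a - b) * l := by
    have h1 := congrArg (v ⬝ᵥ ·) (hsq v hvs)
    simp only [hv, mulVec_smul, dotProduct_add, dotProduct_smul, smul_eq_mul] at h1
    apply mul_right_cancel₀ hv0.ne'
    linarith
  set r : ℝ := a - b - l with hr
  have hrl : r * l = b - d := by rw [hr]; linarith
  have hr0 : 0 ≤ r := by
    by_contra hlt
    have := mul_pos_of_neg_of_neg (not_le.1 hlt) hneg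
    linarith
  have hform : ∀ y : V → ℝ, ∑ i, y i = 0 → y ⬝ᵥ G.adjMatrix ℝ *ᵥ y ≤ r * (y ⬝ᵥ y) := by
    intro y hy
    -- This square equals `(r - l) * (r * (y ⬝ᵥ y) - y ⬝ᵥ A *ᵥ y)`.
    have hz : 0 ≤ (r • y - G.adjMatrix ℝ *ᵥ y) ⬝ᵥ (r • y - G.adjMatrix ℝ *ᵥ y) :=
      Finset.sum_nonneg fun i _ => mul_self_nonneg _
    have hAA : (G.adjMatrix ℝ *ᵥ y) ⬝ᵥ (G.adjMatrix ℝ *ᵥ y) =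
        (d - b : ℝ) * (y ⬝ᵥ y) + (a - b : ℝ) * (y ⬝ᵥ G.adjMatrix ℝ *ᵥ y) := by
      rw [isSymm_dotProduct_mulVec (adjMatrix_isSymm G), hsq y hy, dotProduct_add,
        dotProduct_smul, dotProduct_smul, smul_eq_mul, smul_eq_mul]
    rw [dotProduct_sub, sub_dotProduct, sub_dotProduct, smul_dotProduct, dotProduct_smul,
      dotProduct_smul, smul_dotProduct, hAA, dotProduct_comm (G.adjMatrix ℝ *ᵥ y) y] at hz
    simp only [smul_eq_mul] at hz
    have hab : (a - b : ℝ) = r + l := by rw [hr]; ring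
    have hdb : (d - b : ℝ) = -(r * l) := by linarith
    rw [hab, hdb] at hz
    have : 0 ≤ (r - l) * (r * (y ⬝ᵥ y) - y ⬝ᵥ G.adjMatrix ℝ *ᵥ y) := by linarith
    have := nonneg_of_mul_nonneg_right this (by linarith)
    linarith
  have hlow := le_lovaszTheta_of_form_le hd (by linarith) hform
  have hcard : d + 1 ≤ n := by rw [← h.card]; exact degree_succ_le_card hd
  have hpar : (d : ℝ) * (d - a - 1) = (n - d - 1) * b := by
    have had : a + 1 ≤ d := by
      obtain ⟨x⟩ := ‹Nonempty V›
      obtain ⟨z, hz⟩ := (G.degree_pos_iff_exists_adj x).1 (by rw [hd x]; omega)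
      have h1 := hz.card_commonNeighbors_lt_degree
      rw [h.of_adj x z hz, hd x] at h1
      exact h1
    have h1 : d * (d - a - 1) = (n - d - 1) * b := SimpleGraph.IsSRGWith.param_eq _ h (by omega)
    have h2 : ((d - a - 1 : ℕ) : ℝ) = d - a - 1 := by
      rw [Nat.cast_sub (by omega), Nat.cast_sub (by omega), Nat.cast_one]
    have h3 : ((n - d - 1 : ℕ) : ℝ) = n - d - 1 := by
      rw [Nat.cast_sub (by omega), Nat.cast_sub (by omega), Nat.cast_one]
    rw [← h2, ← h3]
    exact_mod_cast h1
  rw [lovaszBound_le_iff hd h0, ← hl]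
  have hkey : (n - d + r) * (d - l) = -(n * l) * (1 + r) := by
    have hab : (a : ℝ) = r + l + b := by rw [hr]; ring
    rw [hab] at hpar
    linear_combination (-1 : ℝ) * hpar + (n - 1 : ℝ) * hrl
  rw [h.card] at hlow ⊢
  have hdl : (0 : ℝ) ≤ d - l := by
    have : (0 : ℝ) ≤ d := Nat.cast_nonneg d
    linarith
  have := mul_le_mul_of_nonneg_right hlow hdl
  rw [hkey] at this
  refine le_of_mul_le_mul_right ?_ (show 0 < 1 + r by linarith)
  linarith

theorem lovaszBound_top_le (hd : G.IsRegularOfDegree d) (h0 : d ≠ 0) (h : G = ⊤) :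
    lovaszBound G d ≤ 1 := by
  classical
  obtain ⟨v, hv0, hv⟩ := exists_minEigenvector G
  have hvs := sum_eq_zero_of_minEigenvector hd h0 hv
  have hA : G.adjMatrix ℝ = onesMatrix V - 1 := by
    ext i j
    by_cases hij : i = j
    · subst hij; simp
    · simp [h, hij]
  have hl : minEigenvalue G = -1 := by
    have h1 := congrArg (v ⬝ᵥ ·) hv
    simp only [hA, sub_mulVec, one_mulVec, dotProduct_sub, dotProduct_onesMatrix_mulVec, hvs,
      dotProduct_smul, smul_eq_mul] at h1
    apply mul_right_cancel₀ hv0.ne'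
    linarith
  have hcard : (Fintype.card V : ℝ) = d + 1 := by
    obtain ⟨x⟩ := ‹Nonempty V›
    have h1 := hd x
    subst h
    have h2 : d = Fintype.card V - 1 := by
      rw [← h1, ← SimpleGraph.complete_graph_degree x]
      congr!
    have h3 : 0 < Fintype.card V := Fintype.card_pos_iff.2 ⟨x⟩
    have : Fintype.card V = d + 1 := by omega
    exact_mod_cast this
  rw [lovaszBound_le_iff hd h0, hl, hcard]
  linarith

/-- Summing `Z - J` over the `N` automorphisms gives `N s I - N J + q A`, as all edges receive the
same entry. Evaluate at the all-ones vector and at a least eigenvector, then eliminate `q`. -/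
theorem lovaszBound_le_of_edgeTransitive (hd : G.IsRegularOfDegree d) (h0 : d ≠ 0)
    (h : IsEdgeTransitive G) : lovaszBound G d ≤ lovaszTheta G := by
  classical
  have : Finite (G ≃g G) := DFunLike.finite _
  have := Fintype.ofFinite (G ≃g G)
  refine le_lovaszTheta fun s Z hZ => ?_
  set l := minEigenvalue G with hl
  have hneg : l < 0 := minEigenvalue_neg hd h0
  have hd0 : (0 : ℝ) < d := by exact_mod_cast Nat.pos_of_ne_zero h0
  set N : ℝ := ((Fintype.card (G ≃g G) : ℕ) : ℝ) with hN
  have hN0 : 0 < N := by rw [hN]; exact_mod_cast Fintype.card_pos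
  set P : Matrix V V ℝ := ∑ f : G ≃g G, (Z - onesMatrix V).submatrix f f with hP
  have hpsd : P.PosSemidef := posSemidef_sum _ fun f _ => hZ.psd.submatrix f
  have hPapply : ∀ i j, P i j = ∑ f : G ≃g G, (Z (f i) (f j) - 1) := fun i j => by
    simp [hP, Matrix.sum_apply]
  have hsymm : ∀ i j, P i j = P j i := fun i j => ((posSemidef_real_iff.1 hpsd).1.apply i j).symm
  have hinv : ∀ (g : G ≃g G) i j, P (g i) (g j) = P i j := fun g i j => by
    rw [hPapply, hPapply]
    exact Equiv.sum_comp (Equiv.mulRight g) fun f : G ≃g G => Z (f i) (f j) - 1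
  obtain ⟨x⟩ := id ‹Nonempty V›
  obtain ⟨z, hxz⟩ := (G.degree_pos_iff_exists_adj x).1 (by rw [hd x]; omega)
  have hedge : ∀ i j, G.Adj i j → P i j = P x z := by
    intro i j hij
    obtain ⟨g, hg⟩ := h s(x, z) hxz s(i, j) hij
    rw [Sym2.map_mk, Sym2.eq_iff] at hg
    rcases hg with ⟨rfl, rfl⟩ | ⟨rfl, rfl⟩
    · exact hinv g x z
    -- The automorphism may reverse the edge.
    · rw [hsymm]
      exact hinv g x z
  set q : ℝ := P x z + N with hq
  have hPeq : P = (N * s) • 1 - N • onesMatrix V + q • G.adjMatrix ℝ := by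
    ext i j
    by_cases hij : i = j
    · subst hij
      rw [hPapply]
      simp [hZ.diag, hN]
    · by_cases ha : G.Adj i j
      · simp [hedge i j ha, hij, ha, hq]
      · have : ∀ f : G ≃g G, Z (f i) (f j) = 0 := fun f =>
          hZ.nonadj _ _ (fun h => hij (f.injective h)) (by rwa [f.map_adj_iff])
        rw [hPapply]
        simp [this, hij, ha, hN]
  have hn : (0 : ℝ) < Fintype.card V := by exact_mod_cast Fintype.card_pos
  have h1 := (posSemidef_real_iff.1 hpsd).2 fun _ => 1
  obtain ⟨v, hv0, hv⟩ := exists_minEigenvector G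
  have hvs := sum_eq_zero_of_minEigenvector hd h0 hv
  have h2 := (posSemidef_real_iff.1 hpsd).2 v
  simp only [hPeq, add_mulVec, sub_mulVec, smul_mulVec, dotProduct_add, dotProduct_sub,
    dotProduct_smul, dotProduct_onesMatrix_mulVec, hvs, hv, ← hl, one_mulVec, smul_eq_mul] at h2
  simp only [hPeq, add_mulVec, sub_mulVec, smul_mulVec, dotProduct_add, dotProduct_sub,
    dotProduct_smul, dotProduct_onesMatrix_mulVec, adjMatrix_mulVec_one hd, one_mulVec,
    smul_eq_mul] at h1
  simp only [dotProduct, Finset.sum_const, Finset.card_univ, nsmul_eq_mul, mul_one, one_mul] at h1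
  have h3 : 0 ≤ N * s - N * Fintype.card V + q * d := by
    refine nonneg_of_mul_nonneg_right (?_ : 0 ≤ (Fintype.card V : ℝ) * _) hn
    linarith
  have h4 : 0 ≤ N * s + q * l := by
    refine nonneg_of_mul_nonneg_right (?_ : 0 ≤ (v ⬝ᵥ v) * _) hv0
    linarith
  rw [lovaszBound_le_iff hd h0, ← hl]
  refine le_of_mul_le_mul_left ?_ hN0
  linarith [mul_nonneg (neg_nonneg.2 hneg.le) h3, mul_nonneg hd0.le h4]

theorem card_le_lovaszTheta_of_empty (hd : G.IsRegularOfDegree 0) :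
    Fintype.card V ≤ lovaszTheta G := by
  have := le_lovaszTheta_of_form_le hd (r := 0) (by norm_num) fun y _ => by
    simpa using dotProduct_adjMatrix_le hd y
  simpa using this

/-- Lovász's eigenvalue bound is attained by regular graphs that are edge-transitive or strongly
regular. -/
theorem lovaszTheta_eq_lovaszBound (hd : G.IsRegularOfDegree d)
    (h : IsEdgeTransitive G ∨ IsStronglyRegular G) : lovaszTheta G = lovaszBound G d := by
  refine le_antisymm (lovaszTheta_le_lovaszBound hd) ?_
  by_cases h0 : d = 0
  · subst h0
    rw [lovaszBound, if_pos rfl]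
    exact card_le_lovaszTheta_of_empty hd
  rcases h with h | ⟨n, d', a, b, h⟩
  · exact lovaszBound_le_of_edgeTransitive hd h0 h
  · by_cases htop : G = ⊤
    · exact (lovaszBound_top_le hd h0 htop).trans (one_le_lovaszTheta G)
    · obtain ⟨x⟩ := id ‹Nonempty V›
      obtain rfl : d' = d := by rw [← hd x, ← h.regular x]
      exact lovaszBound_le_of_not_complete_of_isSRGWith h h0 htop

end

/-! ### Strong products -/

section

variable {k : ℕ} {V : Fin k → Type*} {G : ∀ l, SimpleGraph (V l)}

/-- The entrywise (Kronecker) product of a family of matrices, indexed by the product of the index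
sets. -/
def piKronecker (M : ∀ l, Matrix (V l) (V l) ℝ) : Matrix (∀ l, V l) (∀ l, V l) ℝ :=
  Matrix.of fun x y => ∏ l, M l (x l) (y l)

/-- Distinct non-adjacent tuples are distinct and non-adjacent in some coordinate, where the factor
vanishes. -/
theorem IsThetaPrimal.strongProduct [∀ l, Fintype (V l)] {s : Fin k → ℝ}
    {Z : ∀ l, Matrix (V l) (V l) ℝ}
    (hZ : ∀ l, IsThetaPrimal (G l) (s l) (Z l)) :
    IsThetaPrimal (strongProduct G) (∏ l, s l) (piKronecker Z) := by
  refine ⟨fun x => by simp [piKronecker, (hZ _).diag], fun x y hxy ha => ?_, ?_⟩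
  · obtain ⟨l, hl⟩ : ∃ l, ¬ (x l = y l ∨ (G l).Adj (x l) (y l)) := by
      by_contra! hc
      exact ha ⟨hxy, hc⟩
    rw [not_or] at hl
    exact Finset.prod_eq_zero (Finset.mem_univ l) ((hZ l).nonadj _ _ hl.1 hl.2)
  · exact posSemidef_hadamard_prod_sub_ones Finset.univ
      (fun l => (Z l).submatrix (fun x : ∀ l, V l => x l) (fun x => x l))
      fun l _ => (hZ l).psd.submatrix fun x : ∀ l, V l => x l

theorem IsThetaDual.strongProduct [∀ l, Fintype (V l)] {Q : ∀ l, Matrix (V l) (V l) ℝ}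
    (hQ : ∀ l, IsThetaDual (G l) (Q l)) : IsThetaDual (strongProduct G) (piKronecker Q) := by
  refine ⟨posSemidef_hadamard_prod Finset.univ
      (fun l => (Q l).submatrix (fun x : ∀ l, V l => x l) (fun x => x l))
      fun l _ => (hQ l).psd.submatrix fun x : ∀ l, V l => x l, fun x y ha => ?_⟩
  obtain ⟨l, hl⟩ := Function.ne_iff.1 ha.1
  exact Finset.prod_eq_zero (Finset.mem_univ l) ((hQ l).adj _ _ ((ha.2 l).resolve_left hl))

theorem sum_pi_prod [∀ l, Fintype (V l)] (f : ∀ l, V l → ℝ) :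
    ∑ x : ∀ l, V l, ∏ l, f l (x l) = ∏ l, ∑ i, f l i := by
  rw [Finset.prod_univ_sum, Fintype.piFinset_univ]

variable [∀ l, Fintype (V l)] [∀ l, Nonempty (V l)]

/-- The theta function is multiplicative with respect to the strong product. -/
theorem lovaszTheta_strongProduct (G : ∀ l, SimpleGraph (V l)) :
    lovaszTheta (strongProduct G) = ∏ l, lovaszTheta (G l) := by
  apply le_antisymm
  -- Primal matrices are taken at `θ + ε`, then `ε` tends to 0.
  · have hcont : Filter.Tendsto (fun ε : ℝ => ∏ l, (lovaszTheta (G l) + ε))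
        (nhdsWithin 0 (Set.Ioi 0)) (nhds (∏ l, (lovaszTheta (G l) + 0))) :=
      ((by fun_prop : Continuous fun ε : ℝ => ∏ l, (lovaszTheta (G l) + ε)).tendsto 0).mono_left
        nhdsWithin_le_nhds
    simp only [add_zero] at hcont
    refine ge_of_tendsto hcont ?_
    filter_upwards [self_mem_nhdsWithin] with ε hε
    choose Z hZ using fun l => exists_isThetaPrimal_of_lt (G := G l)
      (lt_add_of_pos_right (lovaszTheta (G l)) hε)
    exact lovaszTheta_le (IsThetaPrimal.strongProduct hZ)
  · choose Q hQ htr hsum using fun l => exists_isThetaDual (G l)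
    have h := (IsThetaDual.strongProduct hQ).sum_le
    have h1 : (piKronecker Q).trace = 1 := by
      have := sum_pi_prod fun l i => Q l i i
      simp only [Matrix.trace, Matrix.diag] at htr ⊢
      simpa [piKronecker, htr] using this
    have h2 : ∑ x, ∑ y, piKronecker Q x y = ∏ l, lovaszTheta (G l) := by
      simp only [piKronecker, of_apply]
      rw [← Finset.prod_congr rfl fun l _ => hsum l, ← sum_pi_prod]
      exact Finset.sum_congr rfl fun x _ => sum_pi_prod fun l i => Q l (x l) i
    rwa [h1, h2, mul_one] at h

omit [∀ l, Nonempty (V l)] in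
-- Closed neighbourhoods in the strong product are products of closed neighbourhoods.
theorem strongProduct_isRegularOfDegree [∀ l, DecidableRel (G l).Adj]
    [DecidableRel (strongProduct G).Adj] {d : Fin k → ℕ}
    (hd : ∀ l, (G l).IsRegularOfDegree (d l)) :
    (strongProduct G).IsRegularOfDegree (∏ l, (1 + d l) - 1) := by
  classical
  intro x
  have h : insert x ((strongProduct G).neighborFinset x) =
      Fintype.piFinset fun l => insert (x l) ((G l).neighborFinset (x l)) := by
    ext y
    simp only [Finset.mem_insert, SimpleGraph.mem_neighborFinset, Fintype.mem_piFinset]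
    constructor
    · rintro (rfl | h) l
      · exact Or.inl rfl
      · exact (h.2 l).imp Eq.symm id
    · intro h
      by_cases hxy : y = x
      · exact Or.inl hxy
      · exact Or.inr ⟨Ne.symm hxy, fun l => (h l).imp Eq.symm id⟩
  have hc := congrArg Finset.card h
  rw [Finset.card_insert_of_notMem (by simp), Fintype.card_piFinset,
    SimpleGraph.card_neighborFinset_eq_degree] at hc
  have : ∀ l, (insert (x l) ((G l).neighborFinset (x l))).card = 1 + d l := fun l => by
    rw [Finset.card_insert_of_notMem (by simp), SimpleGraph.card_neighborFinset_eq_degree, hd l,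
      add_comm]
  simp only [this] at hc
  omega

end

/-- For a regular graph, the quotient of the order by Lovász's bound is `1 - d / λ_min`. -/
theorem card_div_lovaszBound {V : Type*} [Fintype V] [Nonempty V] {G : SimpleGraph V}
    [DecidableRel G.Adj] {d : ℕ} (hd : G.IsRegularOfDegree d) :
    Fintype.card V / lovaszBound G d = 1 - d / minEigenvalue G := by
  have hn : (Fintype.card V : ℝ) ≠ 0 := by exact_mod_cast Fintype.card_ne_zero
  by_cases h0 : d = 0
  · simp [lovaszBound, h0, hn]
  have hneg := minEigenvalue_neg hd h0
  have hd0 : (0 : ℝ) ≤ d := Nat.cast_nonneg d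
  have h1 : (d : ℝ) - minEigenvalue G ≠ 0 := by linarith
  rw [lovaszBound, if_neg h0]
  field_simp [hneg.ne]
  ring

end StrongProductEigenvalues

open StrongProductEigenvalues in
theorem mainTheorem5 {k : ℕ} {V : Fin k → Type*} [∀ l, Fintype (V l)] [∀ l, Nonempty (V l)]
    (G : ∀ l, SimpleGraph (V l)) [∀ l, DecidableRel (G l).Adj]
    (n d : Fin k → ℕ) (hn : ∀ l, Fintype.card (V l) = n l)
    (hd : ∀ l, (G l).IsRegularOfDegree (d l)) :
    -- (a) unless all factors are complete
    ((¬ ∀ l, G l = ⊤) →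
      secondEigenvalue (strongProduct G) ≥
          ((∏ l, (n l : ℝ)) - ∏ l, (1 + (d l : ℝ))) / ((∏ l, lovaszTheta (G l)) - 1) - 1 ∧
      ((∏ l, (n l : ℝ)) - ∏ l, (1 + (d l : ℝ))) / ((∏ l, lovaszTheta (G l)) - 1) - 1 ≥
          ((∏ l, (n l : ℝ)) - ∏ l, (1 + (d l : ℝ))) / ((∏ l, lovaszBound (G l) (d l)) - 1) - 1 ∧
      ((∀ l, IsEdgeTransitive (G l) ∨ IsStronglyRegular (G l)) →
        ((∏ l, (n l : ℝ)) - ∏ l, (1 + (d l : ℝ))) / ((∏ l, lovaszTheta (G l)) - 1) - 1 =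
          ((∏ l, (n l : ℝ)) - ∏ l, (1 + (d l : ℝ))) /
            ((∏ l, lovaszBound (G l) (d l)) - 1) - 1)) ∧
    -- (b) unless all factors are empty; for an empty factor, `d / λ_min = 0 / 0` is read as `0`
    ((¬ ∀ l, G l = ⊥) →
      minEigenvalue (strongProduct G) ≤
          -(((∏ l, (1 + (d l : ℝ))) - 1) / ((∏ l, (n l : ℝ) / lovaszTheta (G l)) - 1)) ∧
      ((∀ l, IsEdgeTransitive (G l) ∨ IsStronglyRegular (G l)) →
        minEigenvalue (strongProduct G) ≤
          -(((∏ l, (1 + (d l : ℝ))) - 1) /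
            ((∏ l, (1 - (d l : ℝ) / minEigenvalue (G l))) - 1)) ∧
        -(((∏ l, (1 + (d l : ℝ))) - 1) / ((∏ l, (n l : ℝ) / lovaszTheta (G l)) - 1)) =
          -(((∏ l, (1 + (d l : ℝ))) - 1) /
            ((∏ l, (1 - (d l : ℝ) / minEigenvalue (G l))) - 1)))) := by
  classical
  have hreg := strongProduct_isRegularOfDegree (G := G) hd
  set D : ℕ := ∏ l, (1 + d l) - 1 with hD
  have hDcast : (D : ℝ) = ∏ l, (1 + (d l : ℝ)) - 1 := by
    have : 1 ≤ ∏ l, (1 + d l) := Finset.prod_pos fun l _ => Nat.add_pos_left one_pos _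
    rw [hD, Nat.cast_sub this]
    push_cast
    rfl
  have hN : (Fintype.card (∀ l, V l) : ℝ) = ∏ l, (n l : ℝ) := by
    rw [Fintype.card_pi]
    push_cast
    exact Finset.prod_congr rfl fun l _ => by rw [hn]
  have hθ := lovaszTheta_strongProduct G
  have hcard : ∏ l, (1 + (d l : ℝ)) ≤ ∏ l, (n l : ℝ) :=
    Finset.prod_le_prod (fun l _ => by positivity) fun l _ => by
      have := degree_succ_le_card (hd l)
      rw [hn] at this
      rw [add_comm]
      exact_mod_cast this
  refine ⟨fun hne => ?_, fun hne => ?_⟩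
  · have hne' : strongProduct G ≠ ⊤ := by
      intro htop
      refine hne fun l => top_le_iff.1 fun i j hij => ?_
      obtain ⟨x⟩ : Nonempty (∀ l, V l) := inferInstance
      have hadj : (strongProduct G).Adj (Function.update x l i) (Function.update x l j) := by
        rw [htop]
        exact fun h => hij (by simpa using congrFun h l)
      have := hadj.2 l
      simp only [Function.update_self] at this
      exact this.resolve_left hij
    have hV : 1 < Fintype.card (∀ l, V l) := by
      by_contra hle
      have := Fintype.card_le_one_iff_subsingleton.1 (not_lt.1 hle)
      exact hne' (Subsingleton.elim _ _)
    have hT : 1 < ∏ l, lovaszTheta (G l) := hθ ▸ one_lt_lovaszTheta hne'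
    refine ⟨?_, ?_, fun h => ?_⟩
    · have h1 := le_lovaszTheta_of_form_le hreg (neg_one_le_secondEigenvalue hreg hV)
        fun y hy => dotProduct_adjMatrix_le_second hreg hV hy
      rw [hθ, hN, hDcast] at h1
      rw [ge_iff_le, sub_le_iff_le_add, div_le_iff₀ (by linarith)]
      linarith
    · have hle : ∏ l, lovaszTheta (G l) ≤ ∏ l, lovaszBound (G l) (d l) :=
        Finset.prod_le_prod (fun l _ => zero_le_one.trans (one_le_lovaszTheta _))
          fun l _ => lovaszTheta_le_lovaszBound (hd l)
      rw [ge_iff_le]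
      -- The numerator is nonnegative by `hcard` and the smaller denominator positive by `hT`.
      gcongr
    · rw [Finset.prod_congr rfl fun l _ => lovaszTheta_eq_lovaszBound (hd l) (h l)]
  · have hD0 : D ≠ 0 := by
      intro h0
      refine hne fun l => ?_
      have hle : 1 + d l ≤ ∏ l, (1 + d l) :=
        Finset.single_le_prod' (f := fun l => 1 + d l) (fun l _ => by omega) (Finset.mem_univ l)
      have hdl : d l = 0 := by omega
      refine le_bot_iff.1 fun i j hij => ?_
      have := (SimpleGraph.degree_pos_iff_exists_adj (G l) i).2 ⟨j, hij⟩
      rw [hd l i] at this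
      omega
    have hDpos : (0 : ℝ) < D := by exact_mod_cast Nat.pos_of_ne_zero hD0
    have hneg := minEigenvalue_neg hreg hD0
    have hT : 1 ≤ ∏ l, lovaszTheta (G l) := hθ ▸ one_le_lovaszTheta _
    have hmain : minEigenvalue (strongProduct G) ≤
        -(((∏ l, (1 + (d l : ℝ))) - 1) / ((∏ l, (n l : ℝ) / lovaszTheta (G l)) - 1)) := by
      have h1 := lovaszTheta_le_lovaszBound hreg
      rw [lovaszBound, if_neg hD0, le_div_iff₀ (by linarith), hθ, hN] at h1
      rw [← hDcast, Finset.prod_div_distrib]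
      set l := minEigenvalue (strongProduct G) with hl
      set T := ∏ l, lovaszTheta (G l) with hTdef
      set N := ∏ l, (n l : ℝ) with hNdef
      have hT0 : 0 < T := by linarith
      have h2 : T * D ≤ -l * (N - T) := by linarith
      -- Positivity of the denominator is forced by `0 < T * D ≤ -l * (N - T)` with `l < 0`.
      have h3 : 0 < N - T := by
        refine pos_of_mul_pos_right (lt_of_lt_of_le (mul_pos hT0 hDpos) h2) (by linarith)
      have h4 : N / T - 1 = (N - T) / T := by field_simp
      rw [h4, le_neg, div_div_eq_mul_div, div_le_iff₀ h3]
      linarith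
    refine ⟨hmain, fun h => ?_⟩
    have heq : ∏ l, (n l : ℝ) / lovaszTheta (G l) =
        ∏ l, (1 - (d l : ℝ) / minEigenvalue (G l)) :=
      Finset.prod_congr rfl fun l _ => by
        rw [lovaszTheta_eq_lovaszBound (hd l) (h l), ← hn l, card_div_lovaszBound (hd l)]
    exact ⟨heq ▸ hmain, by rw [heq]⟩
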